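/- \textbf{Theorem.} Let $G=(V,\to,\Omega,\mathcal P)$ be a parity game: $V$ is a finite set, ${\to}\subseteq V\times V$ is total (every vertex has a successor), $\Omega:V\to\mathbb N$ and $\mathcal P:V\to\{\mathit{even},\mathit{odd}\}$. Then for all $v,w\in V$, the vertices $v$ and $w$ are governed stuttering bisimilar if and only if Duplicator wins the governed stuttering bisimulation game for the position $(v,w)$. The notions are as follows. \emph{Forcing.} A memoryless strategy of player $i\in\{\mathit{even},\mathit{odd}\}$ is a partial function on the vertices owned by $i$ that maps a vertex to one of its successors. For $U,T\subseteq V$, player $i$ \emph{can force play from $v$ to $T$ via $U$} if $i$ has a memoryless strategy such that every infinite path $p_0p_1\dots$ with $p_0=v$ allowed by it satisfies $p_n\in T$ for some $n$ with $p_j\in U$ for all $j<n$; player $i$ \emph{can force divergence in $U$ from $v$} if $i$ has a memoryless strategy such that all vertices of every such path lie in $U$. \emph{Bisimilarity.} An equivalence relation $R$ on $V$ is a governed stuttering bisimulation if $v\mathrel R w$ implies: (a) $\Omega(v)=\Omega(w)$; (b) for every class $C\in V_{/R}$ with $C\neq[v]_R$, if $v$ has a successor in $C$, then player $\mathcal P(v)$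 can force play from $w$ to $C$ via $[w]_R$; (c) for each player $i$, if $i$ can force divergence in $[v]_R$ from $v$, then $i$ can force divergence in $[w]_R$ from $w$. Vertices $v,w$ are governed stuttering bisimilar if $v\mathrel R w$ for some governed stuttering bisimulation $R$. \emph{The game.} Spoiler and Duplicator play on configurations $((v,w),c)$ with $v,w\in V$ and $c\in(\{0,1\}\times V)\cup\{\dagger,\checkmark\}$. A round from $((v,w),c)$ proceeds as follows. (1) Spoiler chooses $(u_0,u_1)\in\{(v,w),(w,v)\}$. (2) A successor $t_0$ of $u_0$ and a successor $t_1$ of $u_1$ are chosen, in the following order according to $(\mathcal P(u_0),\mathcal P(u_1))$: $(\mathit{even},\mathit{even})$: Spoiler chooses $t_0$, then Duplicator $t_1$; $(\mathit{even},\mathit{odd})$: Spoiler chooses $t_0$, then $t_1$; $(\mathit{odd},\mathit{even})$: Duplicator chooses $t_1$, then $t_0$; $(\mathit{odd},\mathit{odd})$: Spoiler chooses $t_1$, then Duplicator $t_0$. (3) Duplicator selects the next configuration from \[\{((t_0,t_1),\checkmark),\ ((u_0,t_1),\gamma(c,(0,t_0),v,u_0)),\ ((t_0,u_1),\gamma(c,(1,t_1),w,u_1))\},\]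 where $\gamma(c,c',u,t)$ is $c'$ if Spoiler played on $t$, $u=t$ and $c\in\{\dagger,\checkmark,c'\}$; it is $\checkmark$ if $u\neq t$, or if Spoiler played on $t$ and $c\notin\{\dagger,\checkmark,c'\}$; and it is $\dagger$ otherwise. Here, for $t=u_k$, ``Spoiler played on $t$'' means that Spoiler chose $t_k$ in step (2). An infinite play $((v_0,w_0),c_0),((v_1,w_1),c_1),\dots$ is won by Duplicator iff $\Omega(v_j)=\Omega(w_j)$ for all $j$ and $c_k=\checkmark$ for infinitely many $k$. Duplicator wins the game for the position $(v,w)$ iff she has a strategy (which may depend on the history of the play) that wins all plays starting in $((v,w),\checkmark)$. -/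

import Mathlib

/-- The two players of a parity game. -/
inductive Player where
  | even
  | odd

/-- A parity game `(V, →, Ω, P)` on the vertex set `V` (finiteness of `V` is assumed separately). -/
structure ParityGame (V : Type*) where
  /-- the edge relation `v → w` -/
  Edge : V → V → Prop
  /-- the edge relation is total -/
  total : ∀ v, ∃ w, Edge v w
  /-- the priority function `Ω` -/
  prio : V → ℕ
  /-- the owner `P v` of a vertex `v` -/
  owner : V → Player

namespace ParityGame

variable {V : Type*}

/-! ### Forcing reachability and divergence with memoryless strategies -/

/-- `σ` is a memoryless strategy of player `i`: a partial function on the vertices owned by `i`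
that selects successors (`none` means undefined). -/
def IsStrategy (G : ParityGame V) (i : Player) (σ : V → Option V) : Prop :=
  ∀ v w, σ v = some w → G.owner v = i ∧ G.Edge v w

/-- A play from `v` allowed by `σ`: an infinite path starting in `v` that follows `σ`
wherever `σ` is defined. -/
def IsPlayFrom (G : ParityGame V) (σ : V → Option V) (v : V) (p : ℕ → V) : Prop :=
  p 0 = v ∧ (∀ n, G.Edge (p n) (p (n + 1))) ∧ ∀ n w, σ (p n) = some w → p (n + 1) = w

/-- Player `i` can force play from `v` to `T` via `U`. -/
def Forces (G : ParityGame V) (i : Player) (U T : Set V) (v : V) : Prop :=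
  ∃ σ, G.IsStrategy i σ ∧ ∀ p, G.IsPlayFrom σ v p → ∃ n, p n ∈ T ∧ ∀ j < n, p j ∈ U

/-- Player `i` can force play from `v` to diverge in `U`. -/
def Diverges (G : ParityGame V) (i : Player) (U : Set V) (v : V) : Prop :=
  ∃ σ, G.IsStrategy i σ ∧ ∀ p, G.IsPlayFrom σ v p → ∀ j, p j ∈ U

/-! ### Governed stuttering bisimilarity -/

/-- The equivalence class of `v` under `R`. -/
def cls (R : Setoid V) (v : V) : Set V := {u | R v u}

/-- The equivalence relation `R` is a governed stuttering bisimulation. Forcing or diverging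
"via `R`" from a vertex `x` means: via the equivalence class of `x`. -/
def IsGovStutBisim (G : ParityGame V) (R : Setoid V) : Prop :=
  ∀ v w, R v w →
    G.prio v = G.prio w ∧
    (∀ C ∈ R.classes, C ≠ cls R v → (∃ u ∈ C, G.Edge v u) →
      G.Forces (G.owner v) (cls R w) C w) ∧
    (∀ i, G.Diverges i (cls R v) v → G.Diverges i (cls R w) w)

/-- Governed stuttering bisimilarity. -/
def GovStutBisimilar (G : ParityGame V) (v w : V) : Prop :=
  ∃ R : Setoid V, G.IsGovStutBisim R ∧ R v w

/-! ### The governed stuttering bisimulation game -/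

/-- The two players of the bisimulation game. -/
inductive Agent where
  | spoiler
  | duplicator

/-- The challenges and rewards `({0,1} × V) ∪ {†, ✓}`. -/
inductive Challenge (V : Type*) where
  | pending (k : Fin 2) (u : V)
  | dagger
  | check

/-- In a round played from `(u₀, u₁)`, with owners `a` of `u₀` and `b` of `u₁`: who makes the first
move, and on which component of the pair. -/
def firstMove : (a b : Player) → Agent × Fin 2
  | .even, .even => (.spoiler, 0)
  | .even, .odd => (.spoiler, 0)
  | .odd, .even => (.duplicator, 1)
  | .odd, .odd => (.spoiler, 1)

/-- Who makes the second move of such a round, and on which component of the pair. -/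
def secondMove : (a b : Player) → Agent × Fin 2
  | .even, .even => (.duplicator, 1)
  | .even, .odd => (.spoiler, 1)
  | .odd, .even => (.duplicator, 0)
  | .odd, .odd => (.duplicator, 0)

/-- Spoiler is the one who plays on component `k` of `(u₀, u₁)`. -/
def SpoilerPlaysOn (G : ParityGame V) (u₀ u₁ : V) (k : Fin 2) : Prop :=
  firstMove (G.owner u₀) (G.owner u₁) = (.spoiler, k) ∨
    secondMove (G.owner u₀) (G.owner u₁) = (.spoiler, k)

open Classical in
/-- The update `γ(c, c', u, t)` of a challenge; `S` says that Spoiler played on `t`. -/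
noncomputable def update (S : Prop) (c c' : Challenge V) (u t : V) : Challenge V :=
  if S ∧ u = t ∧ (c = .dagger ∨ c = .check ∨ c = c') then c'
  else if u ≠ t ∨ (S ∧ ¬ (c = .dagger ∨ c = .check ∨ c = c')) then .check
  else .dagger

/-- The positions of the game. A round starts in a configuration `((v, w), c)` and passes through
one position of each of the four kinds. -/
inductive Pos (V : Type*) where
  /-- the configuration `((v, w), c)`, in which Spoiler chooses `(u₀, u₁)` -/
  | config (v w : V) (c : Challenge V)
  /-- `(u₀, u₁)` has been chosen, the first move is to be made -/
  | oriented (v w : V) (c : Challenge V) (u₀ u₁ : V)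
  /-- the first move went to `t`, the second move is to be made -/
  | half (v w : V) (c : Challenge V) (u₀ u₁ t : V)
  /-- the players moved to `(t₀, t₁)`, and Duplicator selects the next configuration -/
  | moved (v w : V) (c : Challenge V) (u₀ u₁ t₀ t₁ : V)

/-- Who has to choose the next position. -/
def turn (G : ParityGame V) : Pos V → Agent
  | .config _ _ _ => .spoiler
  | .oriented _ _ _ u₀ u₁ => (firstMove (G.owner u₀) (G.owner u₁)).1
  | .half _ _ _ u₀ u₁ _ => (secondMove (G.owner u₀) (G.owner u₁)).1
  | .moved _ _ _ _ _ _ _ => .duplicator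

/-- The moves of the game. -/
inductive Move (G : ParityGame V) : Pos V → Pos V → Prop
  | keep (v w c) : Move G (.config v w c) (.oriented v w c v w)
  | swap (v w c) : Move G (.config v w c) (.oriented v w c w v)
  | fst_on_zero (v w c u₀ u₁ t₀) :
      (firstMove (G.owner u₀) (G.owner u₁)).2 = 0 → G.Edge u₀ t₀ →
      Move G (.oriented v w c u₀ u₁) (.half v w c u₀ u₁ t₀)
  | fst_on_one (v w c u₀ u₁ t₁) :
      (firstMove (G.owner u₀) (G.owner u₁)).2 = 1 → G.Edge u₁ t₁ →
      Move G (.oriented v w c u₀ u₁) (.half v w c u₀ u₁ t₁)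
  | snd_on_one (v w c u₀ u₁ t₀ t₁) :
      (secondMove (G.owner u₀) (G.owner u₁)).2 = 1 → G.Edge u₁ t₁ →
      Move G (.half v w c u₀ u₁ t₀) (.moved v w c u₀ u₁ t₀ t₁)
  | snd_on_zero (v w c u₀ u₁ t₀ t₁) :
      (secondMove (G.owner u₀) (G.owner u₁)).2 = 0 → G.Edge u₀ t₀ →
      Move G (.half v w c u₀ u₁ t₁) (.moved v w c u₀ u₁ t₀ t₁)
  | both (v w c u₀ u₁ t₀ t₁) :
      Move G (.moved v w c u₀ u₁ t₀ t₁) (.config t₀ t₁ .check)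
  | roll_back_zero (v w c u₀ u₁ t₀ t₁) :
      Move G (.moved v w c u₀ u₁ t₀ t₁)
        (.config u₀ t₁ (update (G.SpoilerPlaysOn u₀ u₁ 0) c (.pending 0 t₀) v u₀))
  | roll_back_one (v w c u₀ u₁ t₀ t₁) :
      Move G (.moved v w c u₀ u₁ t₀ t₁)
        (.config t₀ u₁ (update (G.SpoilerPlaysOn u₀ u₁ 1) c (.pending 1 t₁) w u₁))

/-- `σ` is a (history-dependent) strategy of Duplicator: a partial function on the finite sequences
of positions that end in a position of Duplicator, which selects a legal move. -/
def IsDuplicatorStrategy (G : ParityGame V) (σ : List (Pos V) → Option (Pos V)) : Prop :=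
  ∀ h y, σ h = some y → ∃ x, h.getLast? = some x ∧ G.turn x = .duplicator ∧ G.Move x y

/-- An infinite play of the game from the position `x` that is allowed by `σ`: the strategy is
followed at every finite prefix `q 0, …, q n` at which it is defined. -/
def IsGamePlayFrom (G : ParityGame V) (σ : List (Pos V) → Option (Pos V)) (x : Pos V)
    (q : ℕ → Pos V) : Prop :=
  q 0 = x ∧ (∀ n, G.Move (q n) (q (n + 1))) ∧
    ∀ n y, σ ((List.range (n + 1)).map q) = some y → q (n + 1) = y

/-- Duplicator wins the infinite play `q`: in every configuration on it both vertices have the same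
priority, and infinitely many of its configurations carry a `✓`. -/
def DuplicatorWinsPlay (G : ParityGame V) (q : ℕ → Pos V) : Prop :=
  (∀ n v w c, q n = .config v w c → G.prio v = G.prio w) ∧
    ∀ N, ∃ n ≥ N, ∃ v w, q n = .config v w .check

/-- Duplicator wins the governed stuttering bisimulation game for the position `(v, w)`. -/
def DuplicatorWins (G : ParityGame V) (v w : V) : Prop :=
  ∃ σ, G.IsDuplicatorStrategy σ ∧
    ∀ q, G.IsGamePlayFrom σ (.config v w .check) q → G.DuplicatorWinsPlay q

end ParityGame

/-!
Both directions rest on one observation about the moving order in the bisimulation game: in every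
round, Spoiler acts as `even` on `u₀` and as `odd` on `u₁`, and Duplicator makes the other moves
(`gpre_orient`). So a player of the parity game who can force something from one vertex, but not
from the other, is impersonated by Spoiler on the first vertex, and opposed by him on the second.
Exchanging the two players and the two components is a symmetry, which `side`, `pair` and `orient`
exploit: statements about a player `i` put the vertex on which Spoiler acts as `i` first.

Forcing and divergence are expressed by attractors (`forces_iff`, `diverges_iff`): a player can
force play to `T` via `U` from the vertices of the attractor, and can force divergence in `U` from
the vertices outside the attractor of the opponent to the complement of `U`. Attractors are defined
in arbitrary finite arenas and are used for the bisimulation game too.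

From a governed stuttering bisimulation to a strategy: Duplicator keeps the two vertices related
and moves to a common class, which earns a `✓`, whenever she can. Otherwise
(`IsGovStutBisim.canReply`) one of two things happens, up to the symmetry. Either Spoiler leaves
the class with a move of his on one side, and by the transfer condition for forcing the other
vertex gets closer to the class that he moved to; Duplicator rolls his move back, and he has to
repeat it or concede a `✓` (`IsGovStutBisim.pair_mem_reward_of_pending`). Or one of the vertices has
no successor in its class, and by the transfer condition for divergence the opponent can leave the
class from the other one, which therefore gets closer to leaving it
(`IsGovStutBisim.pair_mem_reward_of_no_succ`). The second situation persists until the next `✓`, and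
so does the first one as long as the second does not occur, so that a `✓` is bound to come.

From winning strategies to a bisimulation: the equivalence relation generated by the pairs of
vertices in configurations from which Duplicator wins, with an arbitrary challenge, is a governed
stuttering bisimulation (`isGovStutBisim_winSetoid`). Working with the generated equivalence avoids
composing strategies: membership in the attractor of a union of classes via a common class passes
along chains, so it suffices to compare the two vertices of one winning configuration. If they
differ, Spoiler follows the attractor on one side and avoids it on the other
(`attack_round`). As all configurations reached stay in the relation, Duplicator must roll back his
progress in almost every round; he then repeats one move, and from some point on no `✓` appears.
This contradicts that from winning positions Duplicator can always force another `✓` through winning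
positions (`winning_subset_attr`).
-/

/-! ### Attractors in finite arenas -/

section Attractor

variable {α : Type*} (D : α → Prop) (E : α → α → Prop)

/-- The controllable predecessor of `K`: the positions from which the player who moves at the
positions in `D` can ensure that the next position lies in `K`. -/
def cpre (K : Set α) : Set α :=
  {x | (D x → ∃ y, E x y ∧ y ∈ K) ∧ (¬ D x → ∀ y, E x y → y ∈ K)}

/-- The positions from which the player of `D` can reach `T` via `U` within `n` moves. -/
def attrN (U T : Set α) : ℕ → Set α
  | 0 => T
  | n + 1 => T ∪ U ∩ cpre D E (attrN U T n)

/-- The attractor of `T` via `U`: the positions from which the player of `D` can reach `T`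
via `U`. -/
def attr (U T : Set α) : Set α := {x | ∃ n, x ∈ attrN D E U T n}

/-- The number of moves needed to reach `T` via `U` (junk value `0` outside the attractor). -/
noncomputable def attrRank (U T : Set α) (x : α) : ℕ := sInf {n | x ∈ attrN D E U T n}

variable {D E} {U T K L : Set α} {x y : α}

theorem cpre_imp (hx : x ∈ cpre D E K) (h : ∀ y, E x y → y ∈ K → y ∈ L) : x ∈ cpre D E L :=
  ⟨fun hD => let ⟨y, hy, hK⟩ := hx.1 hD; ⟨y, hy, h y hy hK⟩,
    fun hD y hy => h y hy (hx.2 hD y hy)⟩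

theorem cpre_mono (h : K ⊆ L) : cpre D E K ⊆ cpre D E L :=
  fun _ hx => cpre_imp hx fun _ _ hy => h hy

theorem mem_cpre_iff {β : Type*} {P : β → Prop} {f : β → α}
    (h : ∀ y, E x y ↔ ∃ t, P t ∧ f t = y) :
    x ∈ cpre D E K ↔ (D x → ∃ t, P t ∧ f t ∈ K) ∧ (¬ D x → ∀ t, P t → f t ∈ K) := by
  simp only [cpre, h, Set.mem_ofPred_eq]
  refine and_congr (imp_congr_right fun _ => ?_) (imp_congr_right fun _ => ?_)
  · exact ⟨fun ⟨_, ⟨t, ht, e⟩, hK⟩ => ⟨t, ht, e ▸ hK⟩, fun ⟨t, ht, hK⟩ => ⟨_, ⟨t, ht, rfl⟩, hK⟩⟩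
  · exact ⟨fun h t ht => h _ ⟨t, ht, rfl⟩, fun h _ ⟨t, ht, e⟩ => e ▸ h t ht⟩

theorem attrN_mono : Monotone (attrN D E U T) := by
  refine monotone_nat_of_le_succ fun n => ?_
  induction n with
  | zero => exact Set.subset_union_left
  | succ n ih => exact
    Set.union_subset_union_right _ (Set.inter_subset_inter_right _ (cpre_mono ih))

theorem subset_attr : T ⊆ attr D E U T := fun _ hx => ⟨0, hx⟩

/-- The attractor is closed under controllable predecessors in `U`. Finiteness bounds the number
of moves uniformly over the replies of the opponent. -/
theorem mem_attr_of_cpre [Finite α] (hU : x ∈ U) (hx : x ∈ cpre D E (attr D E U T)) :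
    x ∈ attr D E U T := by
  choose! n hn using fun (y : α) (hy : y ∈ attr D E U T) => hy
  obtain ⟨N, hN⟩ := (Set.finite_range n).bddAbove
  have : attr D E U T ⊆ attrN D E U T N := fun y hy => attrN_mono (hN ⟨y, rfl⟩) (hn y hy)
  exact ⟨N + 1, Or.inr ⟨hU, cpre_mono this hx⟩⟩

/-- From a position of the attractor outside the target, the player of `D` can stay in the
attractor and decrease the rank. -/
theorem attr_step (hx : x ∈ attr D E U T) (hT : x ∉ T) :
    x ∈ U ∧ x ∈ cpre D E {y | y ∈ attr D E U T ∧ attrRank D E U T y < attrRank D E U T x} := by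
  have h : x ∈ attrN D E U T (attrRank D E U T x) := Nat.sInf_mem hx
  rcases hr : attrRank D E U T x with _ | n
  · rw [hr] at h; exact absurd h hT
  · rw [hr] at h
    obtain h | h := h
    · exact absurd h hT
    · refine ⟨h.1, cpre_mono (fun y hy => ?_) h.2⟩
      exact ⟨⟨n, hy⟩, Nat.lt_succ_of_le (Nat.sInf_le hy)⟩

theorem attr_own (hx : x ∈ attr D E U T) (hT : x ∉ T) (hD : D x) :
    ∃ y, E x y ∧ y ∈ attr D E U T ∧ attrRank D E U T y < attrRank D E U T x :=
  (attr_step hx hT).2.1 hD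

theorem attr_opp (hx : x ∈ attr D E U T) (hT : x ∉ T) (hD : ¬ D x) (hy : E x y) :
    y ∈ attr D E U T ∧ attrRank D E U T y < attrRank D E U T x :=
  (attr_step hx hT).2.2 hD y hy

theorem mem_of_attr (hx : x ∈ attr D E U T) (hT : x ∉ T) : x ∈ U := (attr_step hx hT).1

theorem notMem_attr_own [Finite α] (hx : x ∉ attr D E U T) (hU : x ∈ U) (hD : D x) (hy : E x y) :
    y ∉ attr D E U T :=
  fun h => hx (mem_attr_of_cpre hU ⟨fun _ => ⟨y, hy, h⟩, fun h' => absurd hD h'⟩)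

theorem notMem_attr_opp [Finite α] (hx : x ∉ attr D E U T) (hU : x ∈ U) (hD : ¬ D x) :
    ∃ y, E x y ∧ y ∉ attr D E U T := by
  by_contra! h
  exact hx (mem_attr_of_cpre hU ⟨fun h' => absurd h' hD, fun _ => h⟩)

/-- A path that decreases the rank as long as it has not reached `T` reaches `T`, via `U`. -/
theorem exists_mem_of_attr {p : ℕ → α} (h0 : p 0 ∈ attr D E U T)
    (hp : ∀ n, p n ∈ attr D E U T → p n ∉ T →
      p (n + 1) ∈ attr D E U T ∧ attrRank D E U T (p (n + 1)) < attrRank D E U T (p n)) :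
    ∃ n, p n ∈ T ∧ ∀ j < n, p j ∈ U := by
  induction hr : attrRank D E U T (p 0) using Nat.strong_induction_on generalizing p with
  | _ r ih =>
    by_cases hT : p 0 ∈ T
    · exact ⟨0, hT, by simp⟩
    · obtain ⟨n, hn, hU⟩ := ih _ (hr ▸ (hp 0 h0 hT).2) (p := fun n => p (n + 1)) (hp 0 h0 hT).1
        (fun n => hp (n + 1)) rfl
      refine ⟨n + 1, hn, fun j hj => ?_⟩
      rcases j with _ | j
      · exact mem_of_attr h0 hT
      · exact hU j (by omega)

end Attractor

/-- The opponent of a player. -/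
def Player.other : Player → Player
  | .even => .odd
  | .odd => .even

@[simp] theorem Player.other_other (i : Player) : i.other.other = i := by cases i <;> rfl

theorem Player.eq_other_iff {i j : Player} : j = i.other ↔ j ≠ i := by
  cases i <;> cases j <;> simp [Player.other]

theorem Player.ne_other_iff {i j : Player} : j ≠ i.other ↔ j = i := by
  cases i <;> cases j <;> simp [Player.other]

namespace ParityGame

variable {V : Type*} {G : ParityGame V}

/-! ### Forcing and divergence in terms of attractors -/

/-- The vertices from which player `i` can reach `T` via `U`. -/
abbrev pattr (G : ParityGame V) (i : Player) (U T : Set V) : Set V :=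
  attr (fun x => G.owner x = i) G.Edge U T

/-- The rank of a vertex in the attractor of player `i`. -/
noncomputable abbrev prank (G : ParityGame V) (i : Player) (U T : Set V) (x : V) : ℕ :=
  attrRank (fun x => G.owner x = i) G.Edge U T x

/-- Against a memoryless strategy, the opponent can follow any prescribed choice of successors
at the vertices where the strategy is undefined. -/
theorem exists_play {i : Player} {σ : V → Option V} (hσ : G.IsStrategy i σ) {g : V → V}
    (hg : ∀ x, G.Edge x (g x)) (v : V) :
    ∃ p, G.IsPlayFrom σ v p ∧ ∀ n, σ (p n) = none → p (n + 1) = g (p n) := by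
  refine ⟨fun n => (fun x => (σ x).getD (g x))^[n] v, ⟨rfl, fun n => ?_, fun n w h => ?_⟩,
    fun n h => ?_⟩
  · beta_reduce
    rw [Function.iterate_succ_apply']
    cases h : σ ((fun x => (σ x).getD (g x))^[n] v) with
    | none => simpa [h] using hg _
    | some w => simpa [h] using (hσ _ _ h).2
  · dsimp only at h ⊢
    rw [Function.iterate_succ_apply']; simp [h]
  · dsimp only at h ⊢
    rw [Function.iterate_succ_apply']; simp [h]

theorem forces_iff [Finite V] {i : Player} {U T : Set V} {v : V} :
    G.Forces i U T v ↔ v ∈ G.pattr i U T := by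
  classical
  constructor
  · rintro ⟨σ, hσ, h⟩
    by_contra hv
    have hg : ∀ x, ∃ y, G.Edge x y ∧ (x ∉ G.pattr i U T → x ∈ U → y ∉ G.pattr i U T) := by
      intro x
      by_cases hx : x ∉ G.pattr i U T ∧ x ∈ U
      · by_cases ho : G.owner x = i
        · obtain ⟨y, hy⟩ := G.total x
          exact ⟨y, hy, fun _ _ => notMem_attr_own hx.1 hx.2 ho hy⟩
        · obtain ⟨y, hy, hn⟩ := notMem_attr_opp hx.1 hx.2 ho
          exact ⟨y, hy, fun _ _ => hn⟩
      · obtain ⟨y, hy⟩ := G.total x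
        exact ⟨y, hy, fun h1 h2 => absurd ⟨h1, h2⟩ hx⟩
    choose g hg hg' using hg
    obtain ⟨p, hp, hpg⟩ := exists_play hσ hg v
    obtain ⟨n, hn, hU⟩ := h p hp
    have key : ∀ m ≤ n, p m ∉ G.pattr i U T := by
      intro m
      induction m with
      | zero => intro _; rwa [hp.1]
      | succ m ih =>
        intro hm
        have hm' := ih (by omega)
        cases hs : σ (p m) with
        | none => rw [hpg m hs]; exact hg' _ hm' (hU m hm)
        | some w => exact notMem_attr_own hm' (hU m hm) (hσ _ _ hs).1 (hp.2.1 m)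
    exact key n le_rfl (subset_attr hn)
  · intro hv
    choose! f hf using fun x (h : (x ∈ G.pattr i U T ∧ x ∉ T) ∧ G.owner x = i) =>
      attr_own h.1.1 h.1.2 h.2
    refine ⟨fun x => if (x ∈ G.pattr i U T ∧ x ∉ T) ∧ G.owner x = i then some (f x) else none,
      fun x w h => ?_, fun p hp => exists_mem_of_attr (hp.1 ▸ hv) fun n hn hT => ?_⟩
    · beta_reduce at h
      split_ifs at h with hx
      cases h
      exact ⟨hx.2, (hf x hx).1⟩
    · by_cases ho : G.owner (p n) = i
      · have := hp.2.2 n _ (if_pos ⟨⟨hn, hT⟩, ho⟩)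
        rw [this]
        exact (hf _ ⟨⟨hn, hT⟩, ho⟩).2
      · exact attr_opp hn hT ho (hp.2.1 n)

theorem diverges_iff [Finite V] {i : Player} {U : Set V} {v : V} :
    G.Diverges i U v ↔ v ∉ G.pattr i.other U Uᶜ := by
  classical
  constructor
  · rintro ⟨σ, hσ, h⟩ hv
    have hg : ∀ x, ∃ y, G.Edge x y ∧ (x ∈ G.pattr i.other U Uᶜ → x ∈ U →
        y ∈ G.pattr i.other U Uᶜ ∧ G.prank i.other U Uᶜ y < G.prank i.other U Uᶜ x) := by
      intro x
      by_cases hx : x ∈ G.pattr i.other U Uᶜ ∧ x ∈ U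
      · by_cases ho : G.owner x = i.other
        · obtain ⟨y, hy, h⟩ := attr_own hx.1 (by simpa using hx.2) ho
          exact ⟨y, hy, fun _ _ => h⟩
        · obtain ⟨y, hy⟩ := G.total x
          exact ⟨y, hy, fun _ _ => attr_opp hx.1 (by simpa using hx.2) ho hy⟩
      · obtain ⟨y, hy⟩ := G.total x
        exact ⟨y, hy, fun h1 h2 => absurd ⟨h1, h2⟩ hx⟩
    choose g hg hg' using hg
    obtain ⟨p, hp, hpg⟩ := exists_play hσ hg v
    obtain ⟨n, hn, -⟩ := exists_mem_of_attr (p := p) (hp.1 ▸ hv) fun n hn hT => by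
      cases hs : σ (p n) with
      | none => rw [hpg n hs]; exact hg' _ hn (by simpa using hT)
      | some w =>
        exact attr_opp hn hT (Player.ne_other_iff.2 (hσ _ _ hs).1) (hp.2.1 n)
    exact hn (h p hp n)
  · intro hv
    have hU : ∀ x, x ∉ G.pattr i.other U Uᶜ → x ∈ U := fun x hx => by
      by_contra h; exact hx (subset_attr h)
    choose! f hf using fun x (h : x ∉ G.pattr i.other U Uᶜ ∧ G.owner x = i) =>
      notMem_attr_opp h.1 (hU x h.1) (Player.ne_other_iff.2 h.2)
    refine ⟨fun x => if x ∉ G.pattr i.other U Uᶜ ∧ G.owner x = i then some (f x) else none,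
      fun x w h => ?_, fun p hp j => hU _ ?_⟩
    · beta_reduce at h
      split_ifs at h with hx
      cases h
      exact ⟨hx.2, (hf x hx).1⟩
    · induction j with
      | zero => rwa [hp.1]
      | succ j ih =>
        by_cases ho : G.owner (p j) = i
        · rw [hp.2.2 j _ (if_pos ⟨ih, ho⟩)]
          exact (hf _ ⟨ih, ho⟩).2
        · exact notMem_attr_own ih (hU _ ih) (Player.eq_other_iff.2 ho) (hp.2.1 j)

/-! ### Rounds of the bisimulation game -/

instance [Finite V] : Finite (Challenge V) :=
  Finite.of_surjective
    (fun | .inl (.inl (k, u)) => .pending k u | .inl (.inr _) => .dagger | .inr _ => .check :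
      (Fin 2 × V ⊕ Unit) ⊕ Unit → Challenge V) fun
    | .pending k u => ⟨.inl (.inl (k, u)), rfl⟩
    | .dagger => ⟨.inl (.inr ()), rfl⟩
    | .check => ⟨.inr (), rfl⟩

instance [Finite V] : Finite (Pos V) :=
  Finite.of_surjective
    (fun
      | .inl (.inl (v, w, c)) => .config v w c
      | .inl (.inr (v, w, c, a, b)) => .oriented v w c a b
      | .inr (.inl (v, w, c, a, b, t)) => .half v w c a b t
      | .inr (.inr (v, w, c, a, b, t, s)) => .moved v w c a b t s :
      (V × V × Challenge V ⊕ V × V × Challenge V × V × V) ⊕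
        (V × V × Challenge V × V × V × V ⊕ V × V × Challenge V × V × V × V × V) → Pos V) fun
    | .config v w c => ⟨.inl (.inl (v, w, c)), rfl⟩
    | .oriented v w c a b => ⟨.inl (.inr (v, w, c, a, b)), rfl⟩
    | .half v w c a b t => ⟨.inr (.inl (v, w, c, a, b, t)), rfl⟩
    | .moved v w c a b t s => ⟨.inr (.inr (v, w, c, a, b, t, s)), rfl⟩

/-- The positions from which Duplicator can ensure that the next position lies in `K`. -/
abbrev gpre (G : ParityGame V) (K : Set (Pos V)) : Set (Pos V) :=
  cpre (fun x => G.turn x = .duplicator) G.Move K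

/-- The component of a pair `(u₀, u₁)` on which Spoiler acts as player `i`: whatever the owners
are, Spoiler moves for `even` on `u₀` and for `odd` on `u₁`, and Duplicator makes the other
moves. -/
def side : Player → Fin 2
  | .even => 0
  | .odd => 1

/-- The configuration with challenge `c` in which `a` is the vertex on the side of `i`, and `b` the
vertex on the side of its opponent. -/
def pair (i : Player) (a b : V) (c : Challenge V) : Pos V :=
  match i with
  | .even => .config a b c
  | .odd => .config b a c

/-- The position reached from the configuration `pair i p q c` when Spoiler chooses `(u₀, u₁)` such
that `a` is on the side of `i` and `b` on the other side. -/
def orient (i : Player) (p q : V) (c : Challenge V) (a b : V) : Pos V :=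
  match i with
  | .even => .oriented p q c a b
  | .odd => .oriented q p c b a

/-- After moves from `a` to `t` and from `b` to `s`, Duplicator can select a next configuration
in `K`. The arguments are as in `orient`. -/
def CanSelect (G : ParityGame V) (i : Player) (K : Set (Pos V)) (p q : V) (c : Challenge V)
    (a b t s : V) : Prop :=
  pair i t s .check ∈ K ∨
    pair i a s (update (G.owner a = i) c (.pending (side i) t) p a) ∈ K ∨
    pair i t b (update (G.owner b = i.other) c (.pending (side i.other) s) q b) ∈ K

/-- In step (2) of a round, Duplicator can ensure that the moves from `a` (on the side of `i`) to
`t` and from `b` to `s` satisfy `Φ t s`. -/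
def CanReply (G : ParityGame V) (i : Player) (a b : V) (Φ : V → V → Prop) : Prop :=
  (G.owner a = i → G.owner b = i → ∀ t, G.Edge a t → ∃ s, G.Edge b s ∧ Φ t s) ∧
  (G.owner a = i → G.owner b = i.other → ∀ t s, G.Edge a t → G.Edge b s → Φ t s) ∧
  (G.owner a = i.other → G.owner b = i → ∃ t s, G.Edge a t ∧ G.Edge b s ∧ Φ t s) ∧
  (G.owner a = i.other → G.owner b = i.other → ∀ s, G.Edge b s → ∃ t, G.Edge a t ∧ Φ t s)

theorem pair_other (i : Player) (a b : V) (c : Challenge V) :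
    pair i.other a b c = pair i b a c := by
  cases i <;> rfl

theorem orient_other (i : Player) (p q : V) (c : Challenge V) (a b : V) :
    orient i.other p q c a b = orient i q p c b a := by
  cases i <;> rfl

theorem canSelect_other {i : Player} {K : Set (Pos V)} {p q : V} {c : Challenge V} {a b t s : V} :
    G.CanSelect i.other K p q c a b t s ↔ G.CanSelect i K q p c b a s t := by
  simp only [CanSelect, pair_other, Player.other_other]
  exact or_congr_right or_comm

theorem canReply_other {i : Player} {a b : V} {Φ : V → V → Prop} :
    G.CanReply i.other a b Φ ↔ G.CanReply i b a fun s t => Φ t s := by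
  simp only [CanReply, Player.other_other]
  constructor
  · rintro ⟨h1, h2, h3, h4⟩
    exact ⟨fun x y => h4 y x, fun x y s t es et => h2 y x t s et es,
      fun x y => let ⟨t, s, et, es, h⟩ := h3 y x; ⟨s, t, es, et, h⟩, fun x y => h1 y x⟩
  · rintro ⟨h1, h2, h3, h4⟩
    exact ⟨fun x y => h4 y x, fun x y s t es et => h2 y x t s et es,
      fun x y => let ⟨t, s, et, es, h⟩ := h3 y x; ⟨s, t, es, et, h⟩, fun x y => h1 y x⟩

theorem spoilerPlaysOn_zero {a b : V} : G.SpoilerPlaysOn a b 0 ↔ G.owner a = .even := by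
  unfold SpoilerPlaysOn
  cases G.owner a <;> cases G.owner b <;> simp [firstMove, secondMove]

theorem spoilerPlaysOn_one {a b : V} : G.SpoilerPlaysOn a b 1 ↔ G.owner b = .odd := by
  unfold SpoilerPlaysOn
  cases G.owner a <;> cases G.owner b <;> simp [firstMove, secondMove]

theorem gpre_config {K : Set (Pos V)} {v w : V} {c : Challenge V} :
    .config v w c ∈ G.gpre K ↔ .oriented v w c v w ∈ K ∧ .oriented v w c w v ∈ K := by
  constructor
  · rintro ⟨-, h⟩
    exact ⟨h (by simp [turn]) _ (.keep _ _ _), h (by simp [turn]) _ (.swap _ _ _)⟩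
  · rintro ⟨h1, h2⟩
    refine ⟨by simp [turn], ?_⟩
    rintro - _ (_ | _)
    exacts [h1, h2]

theorem gpre_moved {K : Set (Pos V)} {v w : V} {c : Challenge V} {a b t s : V} :
    .moved v w c a b t s ∈ G.gpre K ↔ G.CanSelect .even K v w c a b t s := by
  simp only [CanSelect, pair, side, Player.other, ← spoilerPlaysOn_zero (b := b),
    ← spoilerPlaysOn_one (a := a)]
  constructor
  · rintro ⟨h, -⟩
    obtain ⟨_, (_ | _ | _), h⟩ := h (by simp [turn])
    exacts [.inl h, .inr (.inl h), .inr (.inr h)]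
  · intro h
    refine ⟨fun _ => ?_, by simp [turn]⟩
    obtain h | h | h := h
    exacts [⟨_, .both .., h⟩, ⟨_, .roll_back_zero .., h⟩, ⟨_, .roll_back_one .., h⟩]

theorem gpre_oriented_zero {K : Set (Pos V)} {v w : V} {c : Challenge V} {a b : V}
    (h : (firstMove (G.owner a) (G.owner b)).2 = 0) : .oriented v w c a b ∈ G.gpre K ↔
      ((firstMove (G.owner a) (G.owner b)).1 = .duplicator →
        ∃ t, G.Edge a t ∧ .half v w c a b t ∈ K) ∧
      ((firstMove (G.owner a) (G.owner b)).1 ≠ .duplicator →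
        ∀ t, G.Edge a t → .half v w c a b t ∈ K) := by
  refine mem_cpre_iff fun y => ⟨?_, ?_⟩
  · rintro (_ | _ | ⟨_, _, _, _, _, t, _, e⟩ | ⟨_, _, _, _, _, t, h', e⟩)
    · exact ⟨t, e, rfl⟩
    · simp [h] at h'
  · rintro ⟨t, e, rfl⟩
    exact .fst_on_zero _ _ _ _ _ _ h e

theorem gpre_oriented_one {K : Set (Pos V)} {v w : V} {c : Challenge V} {a b : V}
    (h : (firstMove (G.owner a) (G.owner b)).2 = 1) : .oriented v w c a b ∈ G.gpre K ↔
      ((firstMove (G.owner a) (G.owner b)).1 = .duplicator →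
        ∃ s, G.Edge b s ∧ .half v w c a b s ∈ K) ∧
      ((firstMove (G.owner a) (G.owner b)).1 ≠ .duplicator →
        ∀ s, G.Edge b s → .half v w c a b s ∈ K) := by
  refine mem_cpre_iff fun y => ⟨?_, ?_⟩
  · rintro (_ | _ | ⟨_, _, _, _, _, t, h', e⟩ | ⟨_, _, _, _, _, t, _, e⟩)
    · simp [h] at h'
    · exact ⟨t, e, rfl⟩
  · rintro ⟨t, e, rfl⟩
    exact .fst_on_one _ _ _ _ _ _ h e

theorem gpre_half_one {K : Set (Pos V)} {v w : V} {c : Challenge V} {a b t : V}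
    (h : (secondMove (G.owner a) (G.owner b)).2 = 1) : .half v w c a b t ∈ G.gpre K ↔
      ((secondMove (G.owner a) (G.owner b)).1 = .duplicator →
        ∃ s, G.Edge b s ∧ .moved v w c a b t s ∈ K) ∧
      ((secondMove (G.owner a) (G.owner b)).1 ≠ .duplicator →
        ∀ s, G.Edge b s → .moved v w c a b t s ∈ K) := by
  refine mem_cpre_iff fun y => ⟨?_, ?_⟩
  · rintro (_ | _ | _ | _ | ⟨_, _, _, _, _, _, s, _, e⟩ | ⟨_, _, _, _, _, _, _, h', e⟩)
    · exact ⟨s, e, rfl⟩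
    · simp [h] at h'
  · rintro ⟨t, e, rfl⟩
    exact .snd_on_one _ _ _ _ _ _ _ h e

theorem gpre_half_zero {K : Set (Pos V)} {v w : V} {c : Challenge V} {a b s : V}
    (h : (secondMove (G.owner a) (G.owner b)).2 = 0) : .half v w c a b s ∈ G.gpre K ↔
      ((secondMove (G.owner a) (G.owner b)).1 = .duplicator →
        ∃ t, G.Edge a t ∧ .moved v w c a b t s ∈ K) ∧
      ((secondMove (G.owner a) (G.owner b)).1 ≠ .duplicator →
        ∀ t, G.Edge a t → .moved v w c a b t s ∈ K) := by
  refine mem_cpre_iff fun y => ⟨?_, ?_⟩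
  · rintro (_ | _ | _ | _ | ⟨_, _, _, _, _, _, _, h', e⟩ | ⟨_, _, _, _, _, t, _, _, e⟩)
    · simp [h] at h'
    · exact ⟨t, e, rfl⟩
  · rintro ⟨t, e, rfl⟩
    exact .snd_on_zero _ _ _ _ _ _ _ h e

theorem gpre_gpre_oriented {K : Set (Pos V)} {v w : V} {c : Challenge V} {a b : V} :
    .oriented v w c a b ∈ G.gpre (G.gpre K) ↔
      G.CanReply .even a b fun t s => .moved v w c a b t s ∈ K := by
  unfold CanReply
  cases ha : G.owner a <;> cases hb : G.owner b
  · rw [gpre_oriented_zero (by simp [ha, hb, firstMove])]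
    simp [gpre_half_one, ha, hb, firstMove, secondMove, Player.other]
  · rw [gpre_oriented_zero (by simp [ha, hb, firstMove])]
    simp only [ha, hb, firstMove, ne_eq, reduceCtorEq, not_false_eq_true, forall_const,
      IsEmpty.forall_iff, true_and, gpre_half_one, secondMove, Player.other, and_true]
    exact ⟨fun h t s e => h t e s, fun h t e s => h t s e⟩
  · rw [gpre_oriented_one (by simp [ha, hb, firstMove])]
    simp only [ha, hb, firstMove, ne_eq, reduceCtorEq, forall_const,
      IsEmpty.forall_iff, true_and, gpre_half_zero, secondMove, Player.other, and_true,
      not_true_eq_false]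
    exact ⟨fun ⟨s, es, t, et, h⟩ => ⟨t, s, et, es, h⟩, fun ⟨t, s, et, es, h⟩ => ⟨s, es, t, et, h⟩⟩
  · rw [gpre_oriented_one (by simp [ha, hb, firstMove])]
    simp [gpre_half_zero, ha, hb, firstMove, secondMove, Player.other]

/-- What the three steps of a round after Spoiler's choice of `(u₀, u₁)` amount to. -/
theorem gpre_orient {K : Set (Pos V)} {i : Player} {p q : V} {c : Challenge V} {a b : V} :
    orient i p q c a b ∈ G.gpre (G.gpre (G.gpre K)) ↔
      G.CanReply i a b (G.CanSelect i K p q c a b) := by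
  have h : ∀ {p q a b}, orient .even p q c a b ∈ G.gpre (G.gpre (G.gpre K)) ↔
      G.CanReply .even a b (G.CanSelect .even K p q c a b) := by
    intro p q a b
    simp only [orient, gpre_gpre_oriented, gpre_moved]
  cases i with
  | even => exact h
  | odd =>
    change orient Player.even.other p q c a b ∈ _ ↔ G.CanReply Player.even.other a b
      (G.CanSelect Player.even.other K p q c a b)
    simp only [orient_other, canReply_other, canSelect_other]
    exact h

theorem gpre_pair {K : Set (Pos V)} {i : Player} {a b : V} {c : Challenge V} :
    pair i a b c ∈ G.gpre K ↔ orient i a b c a b ∈ K ∧ orient i a b c b a ∈ K := by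
  cases i <;> exact gpre_config

/-! ### Updates of the challenge -/

theorem update_of_ne {S : Prop} {c c' : Challenge V} {u t : V} (h : u ≠ t) :
    update S c c' u t = .check := by
  simp [update, h]

theorem update_of_not {S : Prop} {c c' : Challenge V} {u : V} (h : ¬ S) :
    update S c c' u u = .dagger := by
  simp [update, h]

theorem update_of_compatible {S : Prop} {c c' : Challenge V} {u : V} (h : S)
    (hc : c = .dagger ∨ c = .check ∨ c = c') : update S c c' u u = c' := by
  simp [update, h, hc]

theorem update_of_incompatible {S : Prop} {c c' : Challenge V} {u : V} (h : S)
    (hc : ¬ (c = .dagger ∨ c = .check ∨ c = c')) : update S c c' u u = .check := by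
  simp [update, h, hc]

theorem side_ne_side_other (i : Player) : side i ≠ side i.other := by
  cases i <;> simp [side, Player.other]

/-! ### From a bisimulation to a strategy of Duplicator -/

theorem mem_cls {R : Setoid V} {v w : V} : w ∈ cls R v ↔ R v w := Iff.rfl

theorem mem_cls_self {R : Setoid V} (v : V) : v ∈ cls R v := R.refl' v

theorem cls_eq {R : Setoid V} {v w : V} (h : R v w) : cls R v = cls R w :=
  Set.ext fun _ => ⟨fun h' => R.trans' (R.symm' h) h', fun h' => R.trans' h h'⟩

theorem cls_mem_classes {R : Setoid V} (v : V) : cls R v ∈ R.classes :=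
  ⟨v, Set.ext fun _ => ⟨fun h => R.symm' h, fun h => R.symm' h⟩⟩

section Bisimulation

variable {R : Setoid V} {i : Player} {a b t s : V}

/-- If `a` has a successor in another class, then the owner of `a` attracts `b` to that class. -/
theorem IsGovStutBisim.mem_pattr_cls [Finite V] (hR : G.IsGovStutBisim R) (hab : R a b)
    (ha : G.owner a = i) (ht : G.Edge a t) (hat : ¬ R a t) : b ∈ G.pattr i (cls R b) (cls R t) := by
  rw [← ha]
  refine forces_iff.1 ((hR a b hab).2.1 _ (cls_mem_classes t) (fun h => hat ?_)
    ⟨t, mem_cls_self t, ht⟩)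
  rw [← mem_cls, ← h]; exact mem_cls_self t

/-- If `b` has no successor in its class, then player `i` cannot force divergence from `b`, so
that the opponent can leave the class from every vertex in it. -/
theorem IsGovStutBisim.mem_pattr_compl [Finite V] (hR : G.IsGovStutBisim R) (hab : R a b)
    (hb : ∀ s, G.Edge b s → ¬ R b s) (i : Player) : a ∈ G.pattr i.other (cls R a) (cls R a)ᶜ := by
  by_contra h
  refine diverges_iff.1 ((hR a b hab).2.2 i (diverges_iff.2 h)) ?_
  refine mem_attr_of_cpre (mem_cls_self b) ⟨fun _ => ?_, fun _ s hs => subset_attr (hb s hs)⟩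
  obtain ⟨s, hs⟩ := G.total b
  exact ⟨s, hs, subset_attr (hb s hs)⟩

/-- The first half of what Duplicator maintains in a round from `a` and `b`, unless she can move to
two vertices of the same class: either Spoiler, acting as `i`, leaves the class by moving from `a`
to `t`, and the rank of `b` with respect to the class of `t` decreases; or `b` has no successor in
its class, and the rank of `a` with respect to leaving the class decreases. The second half arises
from exchanging the roles of `a` and `b`. -/
def Progress (G : ParityGame V) (R : Setoid V) (i : Player) (a b t s : V) : Prop :=
  (G.owner a = i ∧ ¬ R a t ∧ R b s ∧ s ∈ G.pattr i (cls R b) (cls R t) ∧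
    G.prank i (cls R b) (cls R t) s < G.prank i (cls R b) (cls R t) b) ∨
  (G.owner b = i ∧ (∀ s, G.Edge b s → ¬ R b s) ∧ R a t ∧
    t ∈ G.pattr i.other (cls R a) (cls R a)ᶜ ∧
    G.prank i.other (cls R a) (cls R a)ᶜ t < G.prank i.other (cls R a) (cls R a)ᶜ a)

/-- When player `i` leaves the class of `a`, a move from `b` that decreases the rank with respect to
the new class either reaches that class or stays in the class of `b`. -/
theorem rel_or_progress (ha : G.owner a = i) (hat : ¬ R a t)
    (hs : s ∈ G.pattr i (cls R b) (cls R t) ∧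
      G.prank i (cls R b) (cls R t) s < G.prank i (cls R b) (cls R t) b) :
    R t s ∨ G.Progress R i a b t s := by
  by_cases hts : R t s
  · exact .inl hts
  · exact .inr (.inl ⟨ha, hat, mem_of_attr hs.1 hts, hs⟩)

/-- Duplicator's reply when both vertices belong to `i`. -/
theorem IsGovStutBisim.canReply_of_owner_eq [Finite V] (hR : G.IsGovStutBisim R) (hab : R a b)
    (ha : G.owner a = i) (hb : G.owner b = i) (ht : G.Edge a t) :
    ∃ s, G.Edge b s ∧ (R t s ∨ G.Progress R i a b t s) := by
  by_cases hat : R a t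
  · by_cases h : ∃ s, G.Edge b s ∧ R b s
    · obtain ⟨s, hs, hbs⟩ := h
      exact ⟨s, hs, .inl (R.trans' (R.symm' hat) (R.trans' hab hbs))⟩
    · push Not at h
      obtain ⟨s, hs⟩ := G.total b
      exact ⟨s, hs, .inr (.inr ⟨hb, h, hat,
        attr_opp (hR.mem_pattr_compl hab h i) (fun h' => h' (mem_cls_self a))
          (Player.ne_other_iff.2 ha) ht⟩)⟩
  · obtain ⟨s, hs, hs'⟩ := attr_own (hR.mem_pattr_cls hab ha ht hat)
      (fun h => hat (R.trans' hab (R.symm' h))) hb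
    exact ⟨s, hs, rel_or_progress ha hat hs'⟩

/-- Duplicator's moves when she plays on both vertices and `b` cannot stay in its class: she moves
from `a` towards leaving the class. -/
theorem IsGovStutBisim.canReply_of_no_succ [Finite V] (hR : G.IsGovStutBisim R) (hab : R a b)
    (ha : G.owner a = i.other) (hb : G.owner b = i) (h : ∀ s, G.Edge b s → ¬ R b s) :
    ∃ t s, G.Edge a t ∧ G.Edge b s ∧ (R t s ∨ G.Progress R i a b t s) := by
  obtain ⟨t, ht, ht'⟩ := attr_own (hR.mem_pattr_compl hab h i) (fun h' => h' (mem_cls_self a)) ha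
  obtain ⟨s, hs⟩ := G.total b
  by_cases hat : R a t
  · exact ⟨t, s, ht, hs, .inr (.inr ⟨hb, h, hat, ht'⟩)⟩
  · -- `s` is outside the class of `b` but attracted to that of `t`, hence inside it.
    have hs' := attr_opp (hR.mem_pattr_cls hab ha ht hat) (fun h => hat (R.trans' hab (R.symm' h)))
      (Player.ne_other_iff.2 hb) hs
    refine ⟨t, s, ht, hs, .inl ?_⟩
    by_contra hts
    exact h s hs (mem_of_attr hs'.1 hts)

/-- From two related vertices, Duplicator can move to related vertices or make progress. -/
theorem IsGovStutBisim.canReply [Finite V] (hR : G.IsGovStutBisim R) (hab : R a b)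
    (i : Player) : G.CanReply i a b fun t s =>
      R t s ∨ G.Progress R i a b t s ∨ G.Progress R i.other b a s t := by
  refine ⟨fun ha hb t ht => (hR.canReply_of_owner_eq hab ha hb ht).imp fun s h =>
      ⟨h.1, h.2.imp_right .inl⟩, fun ha hb t s ht hs => ?_,
    fun ha hb => ?_, fun ha hb s hs => ?_⟩
  · by_cases hat : R a t
    · by_cases hbs : R b s
      · exact .inl (R.trans' (R.symm' hat) (R.trans' hab hbs))
      · have h := rel_or_progress hb hbs
          (attr_opp (hR.mem_pattr_cls (R.symm' hab) hb hs hbs)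
            (fun h => hbs (R.trans' (R.symm' hab) (R.symm' h))) (Player.ne_other_iff.2 ha) ht)
        exact h.imp R.symm' .inr
    · exact (rel_or_progress ha hat (attr_opp (hR.mem_pattr_cls hab ha ht hat)
        (fun h => hat (R.trans' hab (R.symm' h))) (Player.eq_other_iff.1 hb) hs)).imp_right .inl
  · by_cases h : ∀ s, G.Edge b s → ¬ R b s
    · obtain ⟨t, s, ht, hs, h⟩ := hR.canReply_of_no_succ hab ha hb h
      exact ⟨t, s, ht, hs, h.imp_right .inl⟩
    by_cases h' : ∀ t, G.Edge a t → ¬ R a t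
    · obtain ⟨s, t, hs, ht, h⟩ := hR.canReply_of_no_succ (i := i.other) (R.symm' hab)
        (by simpa) ha h'
      exact ⟨t, s, ht, hs, h.imp R.symm' .inr⟩
    push Not at h h'
    obtain ⟨t, ht, hat⟩ := h'
    obtain ⟨s, hs, hbs⟩ := h
    exact ⟨t, s, ht, hs, .inl (R.trans' (R.symm' hat) (R.trans' hab hbs))⟩
  · obtain ⟨t, ht, h⟩ := hR.canReply_of_owner_eq (R.symm' hab) hb ha hs
    exact ⟨t, ht, h.imp R.symm' .inr⟩

/-- The positions that are not configurations with vertices of different priorities. -/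
def safe (G : ParityGame V) : Set (Pos V) := {x | ∀ v w c, x = .config v w c → G.prio v = G.prio w}

/-- The configurations with a `✓` in which the vertices are related by `R`. -/
def checked (R : Setoid V) : Set (Pos V) := {x | ∃ v w, x = .config v w .check ∧ R v w}

/-- The positions from which Duplicator can reach a configuration with related vertices and a `✓`,
visiting only configurations with vertices of equal priorities. -/
abbrev reward (G : ParityGame V) (R : Setoid V) : Set (Pos V) :=
  attr (fun x => G.turn x = .duplicator) G.Move G.safe (checked R)

theorem pair_check_mem_reward (hab : R a b) (i : Player) :
    pair i a b .check ∈ G.reward R := by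
  apply subset_attr
  cases i
  exacts [⟨a, b, rfl, hab⟩, ⟨b, a, rfl, R.symm' hab⟩]

theorem CanReply.mono {Φ Ψ : V → V → Prop} (h : G.CanReply i a b Φ)
    (hΦ : ∀ t s, G.Edge a t → G.Edge b s → Φ t s → Ψ t s) : G.CanReply i a b Ψ :=
  ⟨fun ha hb t ht => (h.1 ha hb t ht).imp fun _ h => ⟨h.1, hΦ _ _ ht h.1 h.2⟩,
    fun ha hb t s ht hs => hΦ _ _ ht hs (h.2.1 ha hb t s ht hs),
    fun ha hb => let ⟨t, s, ht, hs, h⟩ := h.2.2.1 ha hb; ⟨t, s, ht, hs, hΦ _ _ ht hs h⟩,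
    fun ha hb s hs => (h.2.2.2 ha hb s hs).imp fun _ h => ⟨h.1, hΦ _ _ h.1 hs h.2⟩⟩

theorem oriented_mem_reward [Finite V] {v w : V} {c : Challenge V}
    (h : .oriented v w c a b ∈ G.gpre (G.gpre (G.gpre (G.reward R)))) :
    .oriented v w c a b ∈ G.reward R :=
  mem_attr_of_cpre (by simp [safe]) <| cpre_imp h fun _ hy h => by
    cases hy <;> exact mem_attr_of_cpre (by simp [safe]) <| cpre_imp h fun _ hy h => by
      cases hy <;> exact mem_attr_of_cpre (by simp [safe]) h

theorem orient_mem_reward [Finite V] {p q : V} {c : Challenge V}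
    (h : G.CanReply i a b (G.CanSelect i (G.reward R) p q c a b)) :
    orient i p q c a b ∈ G.reward R := by
  have h' := gpre_orient.2 h
  cases i <;> exact oriented_mem_reward h'

/-- If Spoiler exchanges the roles of two distinct vertices, then any reply of Duplicator that
keeps the vertices related earns her a `✓`. -/
theorem IsGovStutBisim.orient_swap_mem_reward [Finite V] (hR : G.IsGovStutBisim R) (hab : R a b)
    (hne : a ≠ b) {c : Challenge V} : orient i a b c b a ∈ G.reward R := by
  refine orient_mem_reward ((hR.canReply (R.symm' hab) i).mono fun t s _ _ h => ?_)
  have left : R a s → G.CanSelect i (G.reward R) a b c b a t s := fun h => by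
    refine .inr (.inl ?_)
    rw [update_of_ne hne]
    exact pair_check_mem_reward (R.trans' (R.symm' hab) h) i
  have right : R b t → G.CanSelect i (G.reward R) a b c b a t s := fun h => by
    refine .inr (.inr ?_)
    rw [update_of_ne hne.symm]
    exact pair_check_mem_reward (R.symm' (R.trans' hab h)) i
  obtain h | (⟨-, -, h, -⟩ | ⟨-, -, h, -⟩) | (⟨-, -, h, -⟩ | ⟨-, -, h, -⟩) := h
  exacts [.inl (pair_check_mem_reward h i), left h, right h, right h, left h]

/-- It suffices to deal with the rounds in which Spoiler keeps the roles of the vertices and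
Duplicator makes progress. -/
theorem IsGovStutBisim.orient_mem_reward [Finite V] (hR : G.IsGovStutBisim R) (hab : R a b)
    {c : Challenge V}
    (h1 : ∀ t s, G.Edge a t → G.Edge b s → G.Progress R i a b t s →
      G.CanSelect i (G.reward R) a b c a b t s)
    (h2 : ∀ t s, G.Edge a t → G.Edge b s → G.Progress R i.other b a s t →
      G.CanSelect i (G.reward R) a b c a b t s) :
    orient i a b c a b ∈ G.reward R ∧ orient i a b c b a ∈ G.reward R := by
  have h : orient i a b c a b ∈ G.reward R := by
    refine ParityGame.orient_mem_reward ((hR.canReply hab i).mono fun t s ht hs h => ?_)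
    obtain h | h | h := h
    exacts [.inl (pair_check_mem_reward h i), h1 t s ht hs h, h2 t s ht hs h]
  refine ⟨h, ?_⟩
  by_cases hne : a = b
  · subst hne; exact h
  · exact hR.orient_swap_mem_reward hab hne

theorem IsGovStutBisim.pair_mem_reward [Finite V] (hR : G.IsGovStutBisim R) (hab : R a b)
    {c : Challenge V}
    (h : orient i a b c a b ∈ G.reward R ∧ orient i a b c b a ∈ G.reward R) :
    pair i a b c ∈ G.reward R := by
  refine mem_attr_of_cpre ?_ (gpre_pair.2 h)
  have := (hR a b hab).1
  cases i <;> simp [safe, pair, this]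

/-- If `b` has no successor in its class, then, whatever the challenge, the rank of `a` with respect
to leaving the class decreases until Duplicator earns a `✓`. -/
theorem IsGovStutBisim.pair_mem_reward_of_no_succ [Finite V] (hR : G.IsGovStutBisim R)
    (hab : R a b) (hb : G.owner b = i) (hs : ∀ s, G.Edge b s → ¬ R b s) (c : Challenge V) :
    pair i a b c ∈ G.reward R := by
  induction hn : G.prank i.other (cls R a) (cls R a)ᶜ a using Nat.strong_induction_on
    generalizing a c with
  | _ n ih =>
    refine hR.pair_mem_reward hab (hR.orient_mem_reward hab (fun t s et es h => ?_)
      fun t s et es h => ?_)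
    · obtain ⟨-, -, h, -⟩ | ⟨-, -, h, -, hlt⟩ := h
      · exact absurd h (hs s es)
      · refine .inr (.inr (ih _ (hn ▸ hlt) (R.trans' (R.symm' h) hab) _ ?_))
        rw [cls_eq h]
    · obtain ⟨h, -⟩ | ⟨-, -, h, -⟩ := h
      · exact absurd hb (Player.eq_other_iff.1 h)
      · exact absurd h (hs s es)

/-- While Spoiler insists on moving from `a` to `t` in another class, the rank of the other vertex
with respect to the class of `t` decreases until Duplicator earns a `✓`. -/
theorem IsGovStutBisim.pair_mem_reward_of_pending [Finite V] (hR : G.IsGovStutBisim R)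
    (hab : R a b) (ha : G.owner a = i) (hat : ¬ R a t) :
    pair i a b (.pending (side i) t) ∈ G.reward R := by
  induction hn : G.prank i (cls R b) (cls R t) b using Nat.strong_induction_on
    generalizing b with
  | _ n ih =>
    refine hR.pair_mem_reward hab (hR.orient_mem_reward hab (fun t' s et es h => ?_)
      fun t' s et es h => ?_)
    · obtain ⟨-, -, h, -, hlt⟩ | ⟨hb, hs, h, -⟩ := h
      · refine .inr (.inl ?_)
        by_cases htt : t' = t
        · subst htt
          rw [update_of_compatible ha (.inr (.inr rfl))]
          exact ih _ (hn ▸ hlt) (R.trans' hab h) (by rw [cls_eq h])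
        · rw [update_of_incompatible ha (by simpa using Ne.symm htt)]
          exact pair_check_mem_reward (R.trans' hab h) i
      · exact .inr (.inr (hR.pair_mem_reward_of_no_succ (R.trans' (R.symm' h) hab) hb hs _))
    · obtain ⟨hb, -, h, -⟩ | ⟨h, -⟩ := h
      · refine .inr (.inr ?_)
        rw [update_of_incompatible hb (by simp [side_ne_side_other])]
        exact pair_check_mem_reward (R.trans' (R.symm' h) hab) i
      · exact absurd ha (Player.eq_other_iff.1 h)

/-- After a `✓`, Duplicator can earn another one. -/
theorem IsGovStutBisim.move_mem_reward [Finite V] (hR : G.IsGovStutBisim R) {x y : Pos V}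
    (hx : x ∈ checked R) (hy : G.Move x y) : y ∈ G.reward R := by
  have key : ∀ {i a b t s}, R a b → G.Progress R i a b t s →
      G.CanSelect i (G.reward R) a b .check a b t s := by
    intro i a b t s hab h
    obtain ⟨ha, hat, h, -⟩ | ⟨hb, hs, h, -⟩ := h
    · refine .inr (.inl ?_)
      rw [update_of_compatible ha (.inr (.inl rfl))]
      exact hR.pair_mem_reward_of_pending (R.trans' hab h) ha hat
    · exact .inr (.inr (hR.pair_mem_reward_of_no_succ (R.trans' (R.symm' h) hab) hb hs _))
  obtain ⟨v, w, rfl, h⟩ := hx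
  have := hR.orient_mem_reward (i := .even) h (fun t s _ _ hp => key h hp)
    (fun t s _ _ hp => canSelect_other.1 (key (R.symm' h) hp))
  cases hy
  exacts [this.1, this.2]

theorem IsGovStutBisim.duplicatorWins [Finite V] (hR : G.IsGovStutBisim R) {v w : V}
    (h : R v w) : G.DuplicatorWins v w := by
  classical
  choose! f hf using fun x
      (h : (x ∈ G.reward R ∧ x ∉ checked R) ∧ G.turn x = .duplicator) =>
    attr_own h.1.1 h.1.2 h.2
  refine ⟨fun l => l.getLast?.bind fun x =>
    if (x ∈ G.reward R ∧ x ∉ checked R) ∧ G.turn x = .duplicator then some (f x) else none,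
    fun l y hl => ?_, fun q hq => ?_⟩
  · obtain ⟨x, hx, hy⟩ := Option.bind_eq_some_iff.1 hl
    split_ifs at hy with h
    cases hy
    exact ⟨x, hx, h.2, (hf x h).1⟩
  · have step : ∀ n, q n ∈ G.reward R → q n ∉ checked R → q (n + 1) ∈ G.reward R ∧
        attrRank (fun x => G.turn x = .duplicator) G.Move G.safe (checked R) (q (n + 1)) <
          attrRank (fun x => G.turn x = .duplicator) G.Move G.safe (checked R) (q n) := by
      intro n hn hT
      by_cases hD : G.turn (q n) = .duplicator
      · rw [hq.2.2 n (f (q n)) (by simp [List.range_succ, hn, hT, hD])]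
        exact (hf _ ⟨⟨hn, hT⟩, hD⟩).2
      · exact attr_opp hn hT hD (hq.2.1 n)
    have mem : ∀ n, q n ∈ G.reward R := by
      intro n
      induction n with
      | zero => rw [hq.1]; exact subset_attr ⟨v, w, rfl, h⟩
      | succ n ih =>
        by_cases hT : q n ∈ checked R
        · exact hR.move_mem_reward hT (hq.2.1 n)
        · exact (step n ih hT).1
    refine ⟨fun n a b c hn => ?_, fun N => ?_⟩
    · by_cases hT : q n ∈ checked R
      · obtain ⟨a', b', he, hab⟩ := hT
        rw [hn] at he
        cases he
        exact (hR a b hab).1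
      · exact mem_of_attr (mem n) hT a b c hn
    · obtain ⟨n, ⟨a, b, hn, -⟩, -⟩ := exists_mem_of_attr (p := fun k => q (N + k)) (mem N)
        fun k => step (N + k)
      exact ⟨N + n, by omega, a, b, hn⟩

end Bisimulation

/-! ### From a strategy of Duplicator to a bisimulation -/

theorem exists_move (G : ParityGame V) (x : Pos V) : ∃ y, G.Move x y := by
  have h01 : ∀ k : Fin 2, k = 0 ∨ k = 1 := by decide
  cases x with
  | config v w c => exact ⟨_, .keep v w c⟩
  | oriented v w c a b =>
    obtain ⟨t, ht⟩ := G.total a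
    obtain ⟨s, hs⟩ := G.total b
    obtain h | h := h01 (firstMove (G.owner a) (G.owner b)).2
    exacts [⟨_, .fst_on_zero _ _ _ _ _ _ h ht⟩, ⟨_, .fst_on_one _ _ _ _ _ _ h hs⟩]
  | half v w c a b r =>
    obtain ⟨t, ht⟩ := G.total a
    obtain ⟨s, hs⟩ := G.total b
    obtain h | h := h01 (secondMove (G.owner a) (G.owner b)).2
    exacts [⟨_, .snd_on_zero _ _ _ _ _ _ _ h ht⟩, ⟨_, .snd_on_one _ _ _ _ _ _ _ h hs⟩]
  | moved v w c a b t s => exact ⟨_, .both v w c a b t s⟩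

/-- The strategy `σ` of Duplicator wins all plays from the position `x`. -/
def WinsFrom (G : ParityGame V) (σ : List (Pos V) → Option (Pos V)) (x : Pos V) : Prop :=
  G.IsDuplicatorStrategy σ ∧ ∀ q, G.IsGamePlayFrom σ x q → G.DuplicatorWinsPlay q

/-- The positions from which Duplicator has a winning strategy. -/
def winning (G : ParityGame V) : Set (Pos V) := {x | ∃ σ, G.WinsFrom σ x}

/-- Against a strategy of Duplicator, any prescribed choice of moves can be followed at the
positions of Spoiler. -/
theorem exists_gamePlay {σ : List (Pos V) → Option (Pos V)} (hσ : G.IsDuplicatorStrategy σ)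
    {g : Pos V → Pos V} (hg : ∀ x, G.Move x (g x)) (x : Pos V) :
    ∃ q, G.IsGamePlayFrom σ x q ∧ ∀ n, G.turn (q n) = .spoiler → q (n + 1) = g (q n) := by
  -- `l n` is the history after `n` moves.
  let last : List (Pos V) → Pos V := fun l => l.getLast?.getD x
  let l : ℕ → List (Pos V) := fun n => (fun l => l ++ [(σ l).getD (g (last l))])^[n] [x]
  have hl : ∀ n, l (n + 1) = l n ++ [(σ (l n)).getD (g (last (l n)))] :=
    fun n => Function.iterate_succ_apply' _ n _
  have hne : ∀ n, (l n).getLast? = some (last (l n)) := by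
    intro n
    cases n with
    | zero => rfl
    | succ n => simp [last, hl]
  have hlast : ∀ n, last (l (n + 1)) = (σ (l n)).getD (g (last (l n))) := by
    intro n
    simp [last, hl]
  have hist : ∀ n, (List.range (n + 1)).map (fun k => last (l k)) = l n := by
    intro n
    induction n with
    | zero => rfl
    | succ n ih => rw [List.range_succ, List.map_append, ih, hl, ← hlast]; rfl
  refine ⟨fun n => last (l n), ⟨rfl, fun n => ?_, fun n y hy => ?_⟩, fun n hn => ?_⟩
  · beta_reduce
    rw [hlast]
    cases h : σ (l n) with
    | none => exact hg _
    | some y =>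
      obtain ⟨z, hz, -, hm⟩ := hσ _ _ h
      rw [hne] at hz
      cases hz
      exact hm
  · rw [hist] at hy
    beta_reduce
    rw [hlast, hy]; rfl
  · beta_reduce at hn ⊢
    rw [hlast]
    cases h : σ (l n) with
    | none => rfl
    | some y =>
      obtain ⟨z, hz, ht, -⟩ := hσ _ _ h
      rw [hne] at hz
      cases hz
      rw [hn] at ht
      cases ht

/-- After a first move allowed by a winning strategy, what remains of the strategy is winning. At
the empty history it has to be undefined, since a strategy is defined only at histories that end in
a position of Duplicator. -/
theorem WinsFrom.exists_residual {σ : List (Pos V) → Option (Pos V)} {x y : Pos V}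
    (h : G.WinsFrom σ x) (hm : G.Move x y) (hy : ∀ z, σ [x] = some z → y = z) :
    ∃ τ, G.WinsFrom τ y ∧ ∀ l, l ≠ [] → τ l = σ (x :: l) := by
  classical
  refine ⟨fun l => if l = [] then none else σ (x :: l), ⟨fun l z hl => ?_, fun q hq => ?_⟩,
    fun l hl => if_neg hl⟩
  · beta_reduce at hl
    split_ifs at hl with hne
    obtain ⟨a, ha, h'⟩ := h.1 _ _ hl
    obtain ⟨b, m, rfl⟩ := List.exists_cons_of_ne_nil hne
    exact ⟨a, by simpa using ha, h'⟩
  · let q' : ℕ → Pos V := fun n => n.casesOn x q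
    have hmap : ∀ n, (List.range (n + 2)).map q' = x :: (List.range (n + 1)).map q := by
      intro n
      rw [List.range_succ_eq_map, List.map_cons, List.map_map]
      rfl
    have hw := h.2 q' ⟨rfl, fun n => ?_, fun n z hz => ?_⟩
    · refine ⟨fun n => hw.1 (n + 1), fun N => ?_⟩
      obtain ⟨n, hn, h⟩ := hw.2 (N + 1)
      obtain ⟨n, rfl⟩ := Nat.exists_eq_add_of_le' (Nat.one_le_of_lt hn)
      exact ⟨n, by omega, h⟩
    · cases n with
      | zero => change G.Move x (q 0); rwa [hq.1]
      | succ n => exact hq.2.1 n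
    · cases n with
      | zero => change q 0 = z; rw [hq.1]; exact hy z hz
      | succ n =>
        rw [hmap] at hz
        exact hq.2.2 n z (by simpa using hz)

theorem winning_subset_gpre : G.winning ⊆ G.gpre G.winning := by
  rintro x ⟨σ, hσ⟩
  refine ⟨fun _ => ?_, fun hD y hy => ?_⟩
  · obtain ⟨y, hy, h⟩ : ∃ y, G.Move x y ∧ ∀ z, σ [x] = some z → y = z := by
      cases h : σ [x] with
      | none => obtain ⟨y, hy⟩ := G.exists_move x; exact ⟨y, hy, by simp⟩
      | some y =>
        obtain ⟨z, hz, -, hm⟩ := hσ.1 _ _ h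
        cases hz
        exact ⟨y, hm, by simp⟩
    obtain ⟨τ, hτ, -⟩ := hσ.exists_residual hy h
    exact ⟨y, hy, τ, hτ⟩
  · obtain ⟨τ, hτ, -⟩ := hσ.exists_residual hy fun z hz => by
      obtain ⟨a, ha, ht, -⟩ := hσ.1 _ _ hz
      cases ha
      exact absurd ht hD
    exact ⟨τ, hτ⟩

theorem WinsFrom.mem_winning {σ : List (Pos V) → Option (Pos V)} {x : Pos V}
    (h : G.WinsFrom σ x) {q : ℕ → Pos V} (hq : G.IsGamePlayFrom σ x q) (n : ℕ) :
    q n ∈ G.winning := by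
  induction n generalizing σ x q with
  | zero => rw [hq.1]; exact ⟨σ, h⟩
  | succ n ih =>
    obtain ⟨τ, hτ, he⟩ := h.exists_residual (y := q 1) (hq.1 ▸ hq.2.1 0)
      fun z hz => hq.2.2 0 z (by simpa [hq.1] using hz)
    refine ih (q := fun k => q (k + 1)) hτ ⟨rfl, fun k => hq.2.1 _, fun k z hz => ?_⟩
    rw [he _ (by simp)] at hz
    refine hq.2.2 (k + 1) z ?_
    rw [List.range_succ_eq_map, List.map_cons, List.map_map, hq.1]
    exact hz

theorem prio_eq_of_mem_winning {v w : V} {c : Challenge V} (h : .config v w c ∈ G.winning) :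
    G.prio v = G.prio w := by
  obtain ⟨σ, hσ⟩ := h
  choose g hg using G.exists_move
  obtain ⟨q, hq, -⟩ := exists_gamePlay hσ.1 hg (.config v w c)
  exact (hσ.2 q hq).1 0 v w c hq.1

/-- The winning configurations with a `✓`. -/
def goal (G : ParityGame V) : Set (Pos V) := {x | x ∈ G.winning ∧ ∃ v w, x = .config v w .check}

/-- From a winning position, Duplicator can reach a winning configuration with a `✓` through
winning positions. -/
theorem winning_subset_attr [Finite V] :
    G.winning ⊆ attr (fun x => G.turn x = .duplicator) G.Move G.winning G.goal := by
  set A := attr (fun x => G.turn x = .duplicator) G.Move G.winning G.goal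
  rintro x ⟨σ, hσ⟩
  by_contra hx
  -- Otherwise Spoiler can stay outside the attractor.
  have hg : ∀ x, ∃ y, G.Move x y ∧
      (x ∉ A → x ∈ G.winning → G.turn x = .spoiler → y ∉ A) := by
    intro x
    by_cases h : x ∉ A ∧ x ∈ G.winning ∧ G.turn x = .spoiler
    · obtain ⟨y, hy, hn⟩ := notMem_attr_opp h.1 h.2.1 (by simp [h.2.2])
      exact ⟨y, hy, fun _ _ _ => hn⟩
    · obtain ⟨y, hy⟩ := G.exists_move x
      exact ⟨y, hy, fun h1 h2 h3 => absurd ⟨h1, h2, h3⟩ h⟩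
  choose g hg hg' using hg
  obtain ⟨q, hq, hqg⟩ := exists_gamePlay hσ.1 hg x
  have hn : ∀ n, q n ∉ A := by
    intro n
    induction n with
    | zero => rwa [hq.1]
    | succ n ih =>
      cases ht : G.turn (q n) with
      | spoiler => rw [hqg n ht]; exact hg' _ ih (hσ.mem_winning hq n) ht
      | duplicator => exact notMem_attr_own ih (hσ.mem_winning hq n) ht (hq.2.1 n)
  obtain ⟨n, -, v, w, h⟩ := (hσ.2 q hq).2 0
  exact hn n (subset_attr ⟨hσ.mem_winning hq n, v, w, h⟩)

/-- In a round, Spoiler can impose the move to `t₀` if he plays on `a`, and the move to `s₀` if he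
plays on `b`. -/
theorem CanReply.exists_of_edge {i : Player} {a b t₀ s₀ : V} {Φ : V → V → Prop}
    (h : G.CanReply i a b Φ) (ht : G.Edge a t₀) (hs : G.Edge b s₀) :
    ∃ t s, G.Edge a t ∧ G.Edge b s ∧ (G.owner a = i → t = t₀) ∧
      (G.owner b = i.other → s = s₀) ∧ Φ t s := by
  by_cases ha : G.owner a = i <;> by_cases hb : G.owner b = i
  · obtain ⟨s, es, hΦ⟩ := h.1 ha hb t₀ ht
    exact ⟨t₀, s, ht, es, fun _ => rfl, fun h => absurd hb (Player.eq_other_iff.1 h), hΦ⟩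
  · exact ⟨t₀, s₀, ht, hs, fun _ => rfl, fun _ => rfl,
      h.2.1 ha (Player.eq_other_iff.2 hb) t₀ s₀ ht hs⟩
  · obtain ⟨t, s, et, es, hΦ⟩ := h.2.2.1 (Player.eq_other_iff.2 ha) hb
    exact ⟨t, s, et, es, fun h => absurd h ha, fun h => absurd hb (Player.eq_other_iff.1 h), hΦ⟩
  · obtain ⟨t, et, hΦ⟩ := h.2.2.2 (Player.eq_other_iff.2 ha) (Player.eq_other_iff.2 hb) s₀ hs
    exact ⟨t, s₀, et, hs, fun h => absurd h ha, fun _ => rfl, hΦ⟩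

/-- The equivalence relation generated by the pairs of vertices in winning configurations. -/
def winSetoid (G : ParityGame V) : Setoid V :=
  Relation.EqvGen.setoid fun v w => ∃ c, .config v w c ∈ G.winning

theorem winSetoid_of_pair {i : Player} {a b : V} {c : Challenge V}
    (h : pair i a b c ∈ G.winning) : G.winSetoid a b := by
  cases i
  · exact .rel _ _ ⟨c, h⟩
  · exact .symm _ _ (.rel _ _ ⟨c, h⟩)

/-- No configuration is visited within a round, so a set that Duplicator can stay in until she
reaches the goal is not left during it. -/
theorem orient_mem_gpre {K : Set (Pos V)} (hK : ∀ x ∈ K, x ∉ G.goal → x ∈ G.gpre K) {i : Player}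
    {p q a b : V} {c : Challenge V} (h : orient i p q c a b ∈ K) :
    orient i p q c a b ∈ G.gpre (G.gpre (G.gpre K)) := by
  have key : ∀ {p q a b}, .oriented p q c a b ∈ K →
      .oriented p q c a b ∈ G.gpre (G.gpre (G.gpre K)) := fun h =>
    cpre_imp (hK _ h (by simp [goal])) fun _ hy h => by
      cases hy <;> exact cpre_imp (hK _ h (by simp [goal])) fun _ hy h => by
        cases hy <;> exact hK _ h (by simp [goal])
  cases i <;> exact key h

/-- A successor of `a` for player `i` to move to: it decreases the rank if `i` owns `a`, and is
arbitrary otherwise. -/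
theorem exists_attr_edge {i : Player} {U C : Set V} {a : V} (ha : a ∈ G.pattr i U C)
    (haC : a ∉ C) :
    ∃ t, G.Edge a t ∧ (G.owner a = i →
      t ∈ G.pattr i U C ∧ G.prank i U C t < G.prank i U C a) := by
  by_cases ho : G.owner a = i
  · obtain ⟨t, ht, h⟩ := attr_own ha haC ho
    exact ⟨t, ht, fun _ => h⟩
  · obtain ⟨t, ht⟩ := G.total a
    exact ⟨t, ht, fun h => absurd h ho⟩

section Attack

variable [Finite V] {i : Player} {U C : Set V}

/-- One round of Spoiler's attack from `a` and `b`, when player `i` attracts `a` but not `b` to `C`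
via `U`. Spoiler follows the attractor from `a` and avoids it from `b`. Suppose that Duplicator can
ensure that the next configuration is in a set `K` of winning configurations. She cannot replace
`a`, since this would decrease its rank, which `ih` excludes. So she keeps `a`, the other vertex
remains outside the attractor, and the challenge on the side of `i` is updated. The move `t₀` from
`a` is fixed in advance, so that Spoiler can repeat it. -/
theorem attack_round {a b t₀ p q : V} {c : Challenge V} {K : Set (Pos V)}
    (hK : K ⊆ G.winning)
    (ih : ∀ x y c, x ∈ G.pattr i U C → G.prank i U C x < G.prank i U C a →
      y ∉ G.pattr i U C → pair i x y c ∉ G.winning)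
    (ha : a ∈ G.pattr i U C) (haC : a ∉ C) (hb : b ∉ G.pattr i U C) (hbU : b ∈ U)
    (ht₀ : G.Edge a t₀) (ht₀' : G.owner a = i →
      t₀ ∈ G.pattr i U C ∧ G.prank i U C t₀ < G.prank i U C a)
    (h : G.CanReply i a b (G.CanSelect i K p q c a b)) :
    ∃ t s, (G.owner a = i → t = t₀) ∧ s ∉ G.pattr i U C ∧
      pair i a s (update (G.owner a = i) c (.pending (side i) t) p a) ∈ K := by
  obtain ⟨s₀, hs₀, hs₀'⟩ : ∃ s, G.Edge b s ∧ (G.owner b = i.other → s ∉ G.pattr i U C) := by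
    by_cases ho : G.owner b = i
    · obtain ⟨s, hs⟩ := G.total b
      exact ⟨s, hs, fun h => absurd ho (Player.eq_other_iff.1 h)⟩
    · obtain ⟨s, hs, h⟩ := notMem_attr_opp hb hbU ho
      exact ⟨s, hs, fun _ => h⟩
  obtain ⟨t, s, et, es, htt, hss, hsel⟩ := h.exists_of_edge ht₀ hs₀
  have ht : t ∈ G.pattr i U C ∧ G.prank i U C t < G.prank i U C a := by
    by_cases ho : G.owner a = i
    · rw [htt ho]; exact ht₀' ho
    · exact attr_opp ha haC ho et
  have hs : s ∉ G.pattr i U C := by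
    by_cases ho : G.owner b = i
    · exact notMem_attr_own hb hbU ho es
    · rw [hss (Player.eq_other_iff.2 ho)]; exact hs₀' (Player.eq_other_iff.2 ho)
  obtain h | h | h := hsel
  · exact absurd (hK h) (ih t s _ ht.1 ht.2 hs)
  · exact ⟨t, s, htt, hs, h⟩
  · exact absurd (hK h) (ih t b _ ht.1 ht.2 hb)

/-- If `U` and `C` are unions of classes of `winSetoid`, and player `i` attracts `a` but not `b` to
`C` via `U`, then Duplicator loses from a configuration in which `a` is on the side of `i`: at some
point she has to keep the vertex on that side forever, and Spoiler, repeating his move from it, lets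
her see only finitely many `✓`. -/
theorem pair_notMem_winning {a b : V} {c : Challenge V}
    (hU : ∀ x y, G.winSetoid x y → (x ∈ U ↔ y ∈ U))
    (hC : ∀ x y, G.winSetoid x y → (x ∈ C ↔ y ∈ C))
    (ha : a ∈ G.pattr i U C) (hb : b ∉ G.pattr i U C) :
    pair i a b c ∉ G.winning := by
  induction hn : G.prank i U C a using Nat.strong_induction_on generalizing a b c with
  | _ n ih =>
    subst hn
    intro hw
    have haC : a ∉ C := fun h => hb (subset_attr ((hC _ _ (winSetoid_of_pair hw)).1 h))
    obtain ⟨t₀, ht₀, ht₀'⟩ := exists_attr_edge ha haC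
    have hround : ∀ {b c K}, K ⊆ G.winning → b ∉ G.pattr i U C → pair i a b c ∈ G.winning →
        orient i a b c a b ∈ G.gpre (G.gpre (G.gpre K)) → ∃ t s, (G.owner a = i → t = t₀) ∧
          s ∉ G.pattr i U C ∧
          pair i a s (update (G.owner a = i) c (.pending (side i) t) a a) ∈ K :=
      fun hK hb hw h => attack_round hK (fun _ _ _ hx hlt hy => ih _ hlt hx hy rfl) ha haC hb
        ((hU _ _ (winSetoid_of_pair hw)).1 (mem_of_attr ha haC)) ht₀ ht₀' (gpre_orient.1 h)
    -- The challenge that results from Spoiler's repeated moves.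
    let c₀ : Challenge V := open Classical in
      if G.owner a = i then .pending (side i) t₀ else .dagger
    have hupd : ∀ {c t}, (G.owner a = i → t = t₀) → c = .dagger ∨ c = .check ∨ c = c₀ →
        update (G.owner a = i) c (.pending (side i) t) a a = c₀ := by
      intro c t ht hc
      by_cases ho : G.owner a = i
      · simp only [c₀, if_pos ho, ht ho] at hc ⊢
        exact update_of_compatible ho hc
      · simp only [c₀, if_neg ho]
        exact update_of_not ho
    have hc₀ : c₀ ≠ .check := by
      by_cases ho : G.owner a = i <;> simp [c₀, ho]
    have hwin : ∀ {b c}, b ∉ G.pattr i U C → pair i a b c ∈ G.winning →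
        ∃ t s, (G.owner a = i → t = t₀) ∧ s ∉ G.pattr i U C ∧
          pair i a s (update (G.owner a = i) c (.pending (side i) t) a a) ∈ G.winning :=
      fun hb hw => hround subset_rfl hb hw
        (orient_mem_gpre (fun _ hx _ => winning_subset_gpre hx)
          (gpre_pair.1 (winning_subset_gpre hw)).1)
    -- From now on no `✓` is seen, although Duplicator can decrease the rank of the configuration
    -- with respect to seeing one forever.
    have h₀ : ∀ b, b ∉ G.pattr i U C → pair i a b c₀ ∉ G.winning := by
      intro b hb hw
      induction hm : attrRank (fun x => G.turn x = .duplicator) G.Move G.winning G.goal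
        (pair i a b c₀) using Nat.strong_induction_on generalizing b with
      | _ m ihm =>
        subst hm
        set r := attrRank (fun x => G.turn x = .duplicator) G.Move G.winning G.goal
        let K : Set (Pos V) := {y | y ∈ attr (fun x => G.turn x = .duplicator) G.Move
          G.winning G.goal ∧ r y < r (pair i a b c₀)}
        have hK : K ⊆ G.winning := fun y hy => by
          by_cases hg : y ∈ G.goal
          exacts [hg.1, mem_of_attr hy.1 hg]
        have hpair : pair i a b c₀ ∈ G.gpre K := by
          refine (attr_step (winning_subset_attr hw) ?_).2
          rintro ⟨-, v, w, h⟩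
          cases i <;> simp [pair, hc₀] at h
        have hKstep : ∀ x ∈ K, x ∉ G.goal → x ∈ G.gpre K := fun x hx hg =>
          cpre_imp (attr_step hx.1 hg).2 fun y _ hy => ⟨hy.1, hy.2.trans hx.2⟩
        obtain ⟨t, s, ht, hs, h⟩ := hround hK hb hw
          (orient_mem_gpre hKstep (gpre_pair.1 hpair).1)
        rw [hupd ht (.inr (.inr rfl))] at h
        exact ihm _ h.2 s hs (hK h) rfl
    have h₁ : ∀ b, b ∉ G.pattr i U C → pair i a b .check ∉ G.winning := by
      intro b hb hw
      obtain ⟨t, s, ht, hs, h⟩ := hwin hb hw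
      rw [hupd ht (.inr (.inl rfl))] at h
      exact h₀ s hs h
    obtain ⟨t, s, ht, hs, h⟩ := hwin hb hw
    by_cases hc : c = .dagger ∨ c = .check ∨ c = c₀
    · rw [hupd ht hc] at h
      exact h₀ s hs h
    · by_cases ho : G.owner a = i
      · rw [update_of_incompatible ho (by simpa [c₀, ho, ht ho] using hc)] at h
        exact h₁ s hs h
      · rw [update_of_not ho] at h
        exact h₀ s hs (by simpa [c₀, ho] using h)

/-- The counterpart of `pair_notMem_winning` with `a` on the other side: Spoiler exchanges the roles
of the vertices first. -/
theorem pair_swap_notMem_winning {a b : V} {c : Challenge V}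
    (hU : ∀ x y, G.winSetoid x y → (x ∈ U ↔ y ∈ U))
    (hC : ∀ x y, G.winSetoid x y → (x ∈ C ↔ y ∈ C))
    (ha : a ∈ G.pattr i U C) (hb : b ∉ G.pattr i U C) :
    pair i b a c ∉ G.winning := by
  intro hw
  have hab := winSetoid_of_pair hw
  have haC : a ∉ C := fun h => hb (subset_attr ((hC _ _ hab).2 h))
  obtain ⟨t₀, ht₀, ht₀'⟩ := exists_attr_edge ha haC
  obtain ⟨t, s, -, hs, h⟩ := attack_round (p := b) (q := a) (c := c) subset_rfl
    (fun _ _ _ hx _ hy => pair_notMem_winning hU hC hx hy) ha haC hb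
    ((hU _ _ hab).2 (mem_of_attr ha haC)) ht₀ ht₀'
    (gpre_orient.1 (orient_mem_gpre (fun _ hx _ => winning_subset_gpre hx)
      (gpre_pair.1 (winning_subset_gpre hw)).2))
  exact pair_notMem_winning hU hC ha hs h

theorem mem_pattr_iff {v w : V} {c : Challenge V}
    (hU : ∀ x y, G.winSetoid x y → (x ∈ U ↔ y ∈ U))
    (hC : ∀ x y, G.winSetoid x y → (x ∈ C ↔ y ∈ C))
    (h : .config v w c ∈ G.winning) : v ∈ G.pattr i U C ↔ w ∈ G.pattr i U C := by
  constructor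
  · intro hv
    by_contra hw
    cases i
    exacts [pair_notMem_winning hU hC hv hw h, pair_swap_notMem_winning hU hC hv hw h]
  · intro hw
    by_contra hv
    cases i
    exacts [pair_swap_notMem_winning hU hC hw hv h, pair_notMem_winning hU hC hw hv h]

end Attack

/-- Vertices related by `winSetoid` have the same attracting powers. This passes from the winning
configurations to the equivalence relation that they generate, so that no composition of strategies
is needed. -/
theorem mem_pattr_cls_iff [Finite V] {i : Player} {v w : V} {C : Set V}
    (hC : ∀ x y, G.winSetoid x y → (x ∈ C ↔ y ∈ C)) (h : G.winSetoid v w) :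
    v ∈ G.pattr i (cls G.winSetoid v) C ↔ w ∈ G.pattr i (cls G.winSetoid w) C := by
  induction h with
  | rel v w h =>
    obtain ⟨c, hc⟩ := h
    rw [← cls_eq (R := G.winSetoid) (.rel _ _ ⟨c, hc⟩ : G.winSetoid v w)]
    exact mem_pattr_iff (fun x y hxy => ⟨fun h => G.winSetoid.trans' h hxy,
      fun h => G.winSetoid.trans' h (G.winSetoid.symm' hxy)⟩) hC hc
  | refl => rfl
  | symm _ _ _ ih => exact ih.symm
  | trans _ _ _ _ _ ih1 ih2 => exact ih1.trans ih2

theorem prio_eq_of_winSetoid {v w : V} (h : G.winSetoid v w) : G.prio v = G.prio w := by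
  induction h with
  | rel v w h => exact prio_eq_of_mem_winning h.choose_spec
  | refl => rfl
  | symm _ _ _ ih => exact ih.symm
  | trans _ _ _ _ _ ih1 ih2 => exact ih1.trans ih2

theorem isGovStutBisim_winSetoid [Finite V] : G.IsGovStutBisim G.winSetoid := by
  intro v w h
  refine ⟨prio_eq_of_winSetoid h, fun C hC _ ⟨u, hu, huv⟩ => ?_, fun i => ?_⟩
  · rw [forces_iff, ← mem_pattr_cls_iff ?_ h]
    · exact mem_attr_of_cpre (mem_cls_self v)
        ⟨fun _ => ⟨u, huv, subset_attr hu⟩, fun h => absurd rfl h⟩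
    · obtain ⟨z, rfl⟩ := hC
      exact fun x y hxy => ⟨fun h => G.winSetoid.trans' (G.winSetoid.symm' hxy) h,
        fun h => G.winSetoid.trans' hxy h⟩
  · rw [diverges_iff, diverges_iff, cls_eq h, ← mem_pattr_cls_iff ?_ h, cls_eq h]
    · exact id
    · exact fun x y hxy => not_congr ⟨fun h => G.winSetoid.trans' h hxy,
        fun h => G.winSetoid.trans' h (G.winSetoid.symm' hxy)⟩

end ParityGame

theorem mainTheorem3 {V : Type*} [Finite V] (G : ParityGame V) (v w : V) :
    G.GovStutBisimilar v w ↔ G.DuplicatorWins v w :=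
  ⟨fun ⟨_, hR, h⟩ => hR.duplicatorWins h, fun ⟨σ, hσ⟩ =>
    ⟨G.winSetoid, G.isGovStutBisim_winSetoid, .rel _ _ ⟨.check, σ, hσ⟩⟩⟩
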